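/- A \emph{loop} is a set $Q$ with a binary operation $\cdot$ and a two-sided identity element $1$ such that all left translations $L_x\colon y\mapsto xy$ and all right translations $R_x\colon y\mapsto yx$ are bijections of $Q$. A loop is a \emph{Bol loop} if it satisfies the right Bol identity $((xy)z)y=x((yz)y)$ for all $x,y,z$, or its mirror image, the left Bol identity $y(z(yx))=(y(zy))x$ for all $x,y,z$. The \emph{center} $Z(Q)$ is the set of all $x\in Q$ such that $xy=yx$, $x(yz)=(xy)z$, $y(xz)=(yx)z$ and $y(zx)=(yz)x$ for all $y,z\in Q$. A subloop $N$ of $Q$ is \emph{normal} if $\varphi(N)=N$ for every $\varphi$ in the stabilizer of $1$ in the permutation group generated by all $L_x$ and $R_x$, $x\in Q$; the factor loop $Q/N$ then consists of the cosets $xN$, with $xN\cdot yN=(xy)N$. The \emph{derived subloop} $Q'$ is the smallest normal subloop $N$ of $Q$ such that $Q/N$ is an abelian group. Let $Q$ be a Bol loop of order $27$. If $|Z(Q)|=3$ or $|Q'|=3$, then $Z(Q)=Q'$. -/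

import Mathlib

namespace LoopTheory

/-- A loop `(Q, ·, \, /, 1)`: here `ldiv x y` is `x \ y` and `rdiv x y` is `x / y`. -/
class Loop (Q : Type*) extends MulOneClass Q where
  ldiv : Q → Q → Q
  rdiv : Q → Q → Q
  mul_ldiv : ∀ x y : Q, x * ldiv x y = y
  ldiv_mul : ∀ x y : Q, ldiv x (x * y) = y
  mul_rdiv : ∀ x y : Q, rdiv (x * y) y = x
  rdiv_mul : ∀ x y : Q, rdiv x y * y = x

/-- The right Bol identity. -/
def IsRightBol (Q : Type*) [Loop Q] : Prop :=
  ∀ x y z : Q, ((x * y) * z) * y = x * ((y * z) * y)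

/-- The left Bol identity, the mirror image of the right Bol identity. -/
def IsLeftBol (Q : Type*) [Loop Q] : Prop :=
  ∀ x y z : Q, y * (z * (y * x)) = (y * (z * y)) * x

/-- A Bol loop is a loop that is right Bol or left Bol. -/
def IsBol (Q : Type*) [Loop Q] : Prop := IsRightBol Q ∨ IsLeftBol Q

/-- The loop is an abelian group. -/
def IsAbelianGroup (Q : Type*) [Loop Q] : Prop :=
  (∀ x y z : Q, (x * y) * z = x * (y * z)) ∧ ∀ x y : Q, x * y = y * x

section Center

variable (Q : Type*) [Loop Q]

def leftNucleus : Set Q := {x | ∀ y z : Q, x * (y * z) = (x * y) * z}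

def middleNucleus : Set Q := {x | ∀ y z : Q, y * (x * z) = (y * x) * z}

def rightNucleus : Set Q := {x | ∀ y z : Q, y * (z * x) = (y * z) * x}

def nucleus : Set Q := leftNucleus Q ∩ middleNucleus Q ∩ rightNucleus Q

def commutant : Set Q := {x | ∀ y : Q, x * y = y * x}

/-- The center `Z(Q)`. -/
def center : Set Q := nucleus Q ∩ commutant Q

end Center

section Multiplication

variable {Q : Type*} [Loop Q]

/-- The left translation `y ↦ x * y`. -/
def leftTrans (x : Q) : Equiv.Perm Q where
  toFun y := x * y
  invFun y := Loop.ldiv x y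
  left_inv y := Loop.ldiv_mul x y
  right_inv y := Loop.mul_ldiv x y

/-- The right translation `y ↦ y * x`. -/
def rightTrans (x : Q) : Equiv.Perm Q where
  toFun y := y * x
  invFun y := Loop.rdiv y x
  left_inv y := Loop.mul_rdiv y x
  right_inv y := Loop.rdiv_mul y x

variable (Q) in
/-- The multiplication group `Mlt(Q)`. -/
def mlt : Subgroup (Equiv.Perm Q) :=
  Subgroup.closure (Set.range rightTrans ∪ Set.range leftTrans)

variable (Q) in
/-- The inner mapping group `Inn(Q)`, the stabilizer of `1` in `Mlt(Q)`. -/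
def inn : Subgroup (Equiv.Perm Q) :=
  mlt Q ⊓ MulAction.stabilizer (Equiv.Perm Q) (1 : Q)

end Multiplication

/-- A subloop: a subset containing `1` and closed under the three operations. -/
@[ext]
structure Subloop (Q : Type*) [Loop Q] where
  carrier : Set Q
  one_mem : (1 : Q) ∈ carrier
  mul_mem : ∀ {x y : Q}, x ∈ carrier → y ∈ carrier → x * y ∈ carrier
  ldiv_mem : ∀ {x y : Q}, x ∈ carrier → y ∈ carrier → Loop.ldiv x y ∈ carrier
  rdiv_mem : ∀ {x y : Q}, x ∈ carrier → y ∈ carrier → Loop.rdiv x y ∈ carrier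

namespace Subloop

variable {Q : Type*} [Loop Q]

/-- A subloop is normal if it is mapped onto itself by every inner mapping. -/
class Normal (N : Subloop Q) : Prop where
  image_eq : ∀ φ ∈ inn Q, φ '' N.carrier = N.carrier

/-- The coset `xN`. -/
def coset (N : Subloop Q) (x : Q) : Set Q := leftTrans x '' N.carrier

/-- Two elements are identified in `Q / N` if their cosets `xN` and `yN` are equal. -/
def cosetSetoid (N : Subloop Q) : Setoid Q := Setoid.ker N.coset

/-- The set `Q / N` of cosets `xN`. -/
def Factor (N : Subloop Q) : Type _ := Quotient N.cosetSetoid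

theorem leftTrans_mem (x : Q) : leftTrans x ∈ mlt Q :=
  Subgroup.subset_closure (Or.inr ⟨x, rfl⟩)

theorem rightTrans_mem (x : Q) : rightTrans x ∈ mlt Q :=
  Subgroup.subset_closure (Or.inl ⟨x, rfl⟩)

/-- Elements of `Mlt(Q)` that agree at `1` have the same effect on a normal subloop. -/
theorem image_eq_image (N : Subloop Q) [hN : N.Normal] {f g : Equiv.Perm Q}
    (hf : f ∈ mlt Q) (hg : g ∈ mlt Q) (h : f 1 = g 1) :
    f '' N.carrier = g '' N.carrier := by
  have hmem : g⁻¹ * f ∈ inn Q := by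
    refine Subgroup.mem_inf.2 ⟨Subgroup.mul_mem _ (inv_mem hg) hf, ?_⟩
    rw [MulAction.mem_stabilizer_iff, Equiv.Perm.smul_def, Equiv.Perm.mul_apply, h]
    exact g.symm_apply_apply 1
  have h1 := hN.image_eq _ hmem
  have h2 : g '' ((g⁻¹ * f) '' N.carrier) = f '' N.carrier := by
    rw [← Set.image_comp, ← Equiv.Perm.coe_mul, mul_inv_cancel_left]
  rw [← h2, h1]

theorem leftTrans_image_coset (N : Subloop Q) [N.Normal] (x y : Q) :
    leftTrans x '' N.coset y = N.coset (x * y) := by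
  have h := N.image_eq_image (f := leftTrans x * leftTrans y) (g := leftTrans (x * y))
    (Subgroup.mul_mem _ (leftTrans_mem x) (leftTrans_mem y)) (leftTrans_mem _)
    (by simp [leftTrans])
  rw [coset, coset, ← h, Equiv.Perm.coe_mul, Set.image_comp]

theorem rightTrans_image_coset (N : Subloop Q) [N.Normal] (x y : Q) :
    rightTrans y '' N.coset x = N.coset (x * y) := by
  have h := N.image_eq_image (f := rightTrans y * leftTrans x) (g := leftTrans (x * y))
    (Subgroup.mul_mem _ (rightTrans_mem y) (leftTrans_mem x)) (leftTrans_mem _)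
    (by simp [leftTrans, rightTrans])
  rw [coset, coset, ← h, Equiv.Perm.coe_mul, Set.image_comp]

theorem coset_mul_congr (N : Subloop Q) [N.Normal] {x x' y y' : Q}
    (hx : N.coset x = N.coset x') (hy : N.coset y = N.coset y') :
    N.coset (x * y) = N.coset (x' * y') := by
  rw [← leftTrans_image_coset, hy, leftTrans_image_coset, ← rightTrans_image_coset, hx,
    rightTrans_image_coset]

theorem coset_ldiv_congr (N : Subloop Q) [N.Normal] {x x' y y' : Q}
    (hx : N.coset x = N.coset x') (hy : N.coset y = N.coset y') :
    N.coset (Loop.ldiv x y) = N.coset (Loop.ldiv x' y') := by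
  apply (leftTrans x).injective.image_injective
  have h := N.coset_mul_congr hx (rfl : N.coset (Loop.ldiv x' y') = _)
  rw [leftTrans_image_coset, leftTrans_image_coset, h, Loop.mul_ldiv, Loop.mul_ldiv, hy]

theorem coset_rdiv_congr (N : Subloop Q) [N.Normal] {x x' y y' : Q}
    (hx : N.coset x = N.coset x') (hy : N.coset y = N.coset y') :
    N.coset (Loop.rdiv x y) = N.coset (Loop.rdiv x' y') := by
  apply (rightTrans y).injective.image_injective
  have h := N.coset_mul_congr (rfl : N.coset (Loop.rdiv x' y') = _) hy
  rw [rightTrans_image_coset, rightTrans_image_coset, h, Loop.rdiv_mul, Loop.rdiv_mul, hx]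

/-- The factor loop `Q / N`, with `xN · yN = (xy)N`. -/
instance factorLoop (N : Subloop Q) [N.Normal] : Loop N.Factor where
  mul := Quotient.map₂ (· * ·) fun _ _ hx _ _ hy => N.coset_mul_congr hx hy
  one := Quotient.mk _ 1
  ldiv := Quotient.map₂ Loop.ldiv fun _ _ hx _ _ hy => N.coset_ldiv_congr hx hy
  rdiv := Quotient.map₂ Loop.rdiv fun _ _ hx _ _ hy => N.coset_rdiv_congr hx hy
  one_mul := by
    rintro ⟨x⟩
    exact congrArg (Quotient.mk N.cosetSetoid) (one_mul x)
  mul_one := by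
    rintro ⟨x⟩
    exact congrArg (Quotient.mk N.cosetSetoid) (mul_one x)
  mul_ldiv := by
    rintro ⟨x⟩ ⟨y⟩
    exact congrArg (Quotient.mk N.cosetSetoid) (Loop.mul_ldiv x y)
  ldiv_mul := by
    rintro ⟨x⟩ ⟨y⟩
    exact congrArg (Quotient.mk N.cosetSetoid) (Loop.ldiv_mul x y)
  mul_rdiv := by
    rintro ⟨x⟩ ⟨y⟩
    exact congrArg (Quotient.mk N.cosetSetoid) (Loop.mul_rdiv x y)
  rdiv_mul := by
    rintro ⟨x⟩ ⟨y⟩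
    exact congrArg (Quotient.mk N.cosetSetoid) (Loop.rdiv_mul x y)

/-- `N` is a normal subloop and the factor loop `Q / N` is an abelian group. -/
def HasAbelianFactor (N : Subloop Q) : Prop :=
  ∃ _ : N.Normal, IsAbelianGroup N.Factor

end Subloop

/-- The derived subloop `Q'`: the intersection of all normal subloops `N` such that `Q / N` is
an abelian group. It is the smallest such `N`, see `derivedSubloop_isLeast`. -/
def derivedSubloop (Q : Type*) [Loop Q] : Subloop Q where
  carrier := {x | ∀ N : Subloop Q, N.HasAbelianFactor → x ∈ N.carrier}
  one_mem N _ := N.one_mem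
  mul_mem hx hy N hN := N.mul_mem (hx N hN) (hy N hN)
  ldiv_mem hx hy N hN := N.ldiv_mem (hx N hN) (hy N hN)
  rdiv_mem hx hy N hN := N.rdiv_mem (hx N hN) (hy N hN)

section Derived

variable {Q : Type*} [Loop Q]

theorem Subloop.coset_eq_iff (N : Subloop Q) [N.Normal] (x y : Q) :
    N.coset x = N.coset y ↔ Loop.ldiv x y ∈ N.carrier := by
  constructor
  · intro h
    have hy : y ∈ N.coset x := by
      rw [h]
      exact ⟨1, N.one_mem, mul_one y⟩
    obtain ⟨n, hn, rfl⟩ := hy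
    have : Loop.ldiv x (leftTrans x n) = n := Loop.ldiv_mul x n
    rwa [this]
  · intro h
    have h1 : N.coset (Loop.ldiv x y) = N.coset 1 := by
      ext z
      constructor
      · rintro ⟨n, hn, rfl⟩
        exact ⟨_, N.mul_mem h hn, one_mul _⟩
      · rintro ⟨n, hn, rfl⟩
        refine ⟨_, N.ldiv_mem h hn, ?_⟩
        exact (Loop.mul_ldiv _ _).trans (one_mul n).symm
    have h2 := N.leftTrans_image_coset x (Loop.ldiv x y)
    rw [Loop.mul_ldiv, h1, N.leftTrans_image_coset, mul_one] at h2
    exact h2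

theorem Subloop.isAbelianGroup_factor_iff (N : Subloop Q) [N.Normal] :
    IsAbelianGroup N.Factor ↔
      (∀ x y z : Q, Loop.ldiv ((x * y) * z) (x * (y * z)) ∈ N.carrier) ∧
        ∀ x y : Q, Loop.ldiv (x * y) (y * x) ∈ N.carrier := by
  simp only [← N.coset_eq_iff]
  constructor
  · rintro ⟨h1, h2⟩
    exact ⟨fun x y z => Quotient.exact (h1 (Quotient.mk _ x) (Quotient.mk _ y) (Quotient.mk _ z)),
      fun x y => Quotient.exact (h2 (Quotient.mk _ x) (Quotient.mk _ y))⟩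
  · rintro ⟨h1, h2⟩
    constructor
    · rintro ⟨x⟩ ⟨y⟩ ⟨z⟩
      exact Quotient.sound (h1 x y z)
    · rintro ⟨x⟩ ⟨y⟩
      exact Quotient.sound (h2 x y)

instance derivedSubloop_normal : (derivedSubloop Q).Normal where
  image_eq := by
    have key : ∀ φ ∈ inn Q, ∀ x ∈ (derivedSubloop Q).carrier,
        φ x ∈ (derivedSubloop Q).carrier := by
      intro φ hφ x hx N hN
      rw [← hN.1.image_eq φ hφ]
      exact ⟨x, hx N hN, rfl⟩
    intro φ hφ
    ext y
    constructor
    · rintro ⟨x, hx, rfl⟩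
      exact key φ hφ x hx
    · intro hy
      exact ⟨φ⁻¹ y, key _ (inv_mem hφ) y hy, φ.apply_symm_apply y⟩

/-- The derived subloop is the smallest normal subloop whose factor loop is an abelian group. -/
theorem derivedSubloop_isLeast :
    (derivedSubloop Q).HasAbelianFactor ∧
      ∀ N : Subloop Q, N.HasAbelianFactor → (derivedSubloop Q).carrier ⊆ N.carrier := by
  refine ⟨⟨derivedSubloop_normal, ?_⟩, fun N hN x hx => hx N hN⟩
  rw [Subloop.isAbelianGroup_factor_iff]
  refine ⟨fun x y z N hN => ?_, fun x y N hN => ?_⟩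
  · obtain ⟨h, hab⟩ := hN
    exact (N.isAbelianGroup_factor_iff.1 hab).1 x y z
  · obtain ⟨h, hab⟩ := hN
    exact (N.isAbelianGroup_factor_iff.1 hab).2 x y

end Derived

end LoopTheory

/-! Passing to the opposite loop reduces the main lemmas to right Bol loops. Two facts carry the
proof: a Bol loop of order 9 is an abelian group (`IsBol.isAbelianGroup_of_card_nine`), and the
kernel of a homomorphism onto an abelian group of odd order is central if it has order 3
(`IsBol.mem_center_of_card_ker`).

If |Z(Q)| = 3, the first fact gives Q' ⊆ Z(Q), and Q' ≠ 1 because Q is not an abelian group. If |Q'|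
= 3, the second gives Q' ⊆ Z(Q); a larger center would make Q/Z(Q) cyclic, hence Q an abelian group
and Q' = 1.

For the second fact, let n generate the kernel. The cosets are the 3-cycles of R_n, and each R_y
carries cosets to cosets, preserving or reversing the cyclic orientation. This sign depends only on
the two cosets involved, so it is a function A × A → ℤ/2. The Bol identity becomes a functional
equation whose only normalized solution is zero when |A| is odd (`sign_eq_zero`). Hence R_n commutes
with every R_y, and centrality follows. -/

namespace LoopTheory

/-! ### Sign functions satisfying the Bol condition -/

section Sign

variable {A : Type*} [AddCommGroup A] {f : A → A → ZMod 2}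

theorem sign_neg_right
    (hB : ∀ c y z, f c (y + z + y) = f c y + f (c + y) z + f (c + y + z) y) (c y : A) :
    f c (-y) = f (c - y) y := by
  have h := hB (c - y) y (-y)
  rw [show y + -y + y = y by abel, show c - y + y + -y = c - y by abel,
    show c - y + y = c by abel] at h
  grind

/-- Follow the signs from c along the steps -x, -(y+z), z, y, x, 0, x, y, z, -(y+z), -x. This
palindrome comes from nested uses of the Bol condition and its steps add up to 0, so its signs sum
to `f c 0 = 0`. By `sign_neg_right` the steps by ±x cancel in pairs; what remains is the two sides.
-/
theorem sign_defect_symm (hr : ∀ c, f c 0 = 0)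
    (hB : ∀ c y z, f c (y + z + y) = f c y + f (c + y) z + f (c + y + z) y) (c x y z : A) :
    f (c - x - (y + z)) z + f (c - x - (y + z) + z) y + f (c - x - (y + z)) (y + z) =
      f (c + x) y + f (c + x + y) z + f (c + x) (y + z) := by
  have h1 := hB c (-x) (-(y + z) + (z + (y + (x + 0 + x) + y) + z) + -(y + z))
  have h2 := hB (c + -x) (-(y + z)) (z + (y + (x + 0 + x) + y) + z)
  have h3 := hB (c + -x + -(y + z)) z (y + (x + 0 + x) + y)
  have h4 := hB (c + -x + -(y + z) + z) y (x + 0 + x)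
  have h5 := hB (c + -x + -(y + z) + z + y) x 0
  have e : -x + (-(y + z) + (z + (y + (x + 0 + x) + y) + z) + -(y + z)) + -x = 0 := by abel
  rw [e, hr] at h1
  rw [hr] at h5
  have n1 := sign_neg_right hB c x
  have n2 := sign_neg_right hB (c - x) (y + z)
  have n3 := sign_neg_right hB (c + x + (y + z)) (y + z)
  have n4 := sign_neg_right hB (c + x) x
  rw [show c + -x = c - x by abel] at *
  rw [show c - x + -(y + z) = c - x - (y + z) by abel] at *
  rw [show c - x - (y + z) + z + y = c - x by abel] at *
  rw [show c - x + x + 0 = c by abel] at *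
  rw [show c - x + (x + 0 + x) = c + x by abel] at *
  rw [show c - x - (y + z) + z + (y + (x + 0 + x) + y) = c + x + y by abel] at *
  rw [show c - x - (y + z) + (z + (y + (x + 0 + x) + y) + z) = c + x + (y + z) by abel] at *
  rw [show c - x + (-(y + z) + (z + (y + (x + 0 + x) + y) + z) + -(y + z)) = c + x by abel] at *
  rw [show c + x + (y + z) - (y + z) = c + x by abel] at n3
  rw [show c + x - x = c by abel] at n4
  grind

/-- A normalized sign function on a finite abelian group of odd order vanishes if it satisfies
the Bol condition. -/
theorem sign_eq_zero [Finite A] (hA : Odd (Nat.card A)) (hl : ∀ y, f 0 y = 0)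
    (hr : ∀ c, f c 0 = 0)
    (hB : ∀ c y z, f c (y + z + y) = f c y + f (c + y) z + f (c + y + z) y) (y z : A) :
    f y z = 0 := by
  have := Fintype.ofFinite A
  have half : ∀ d : A, ∃ c, c + c = d := by
    intro d
    obtain ⟨k, hk⟩ := hA
    refine ⟨(k + 1) • d, ?_⟩
    rw [← add_nsmul, show k + 1 + (k + 1) = Nat.card A + 1 by omega, add_nsmul, one_nsmul,
      card_nsmul_eq_zero', zero_add]
  -- For x = c the left side of `sign_defect_symm` does not depend on c. Comparing d = c + c with d
  -- = 0, where `f 0` vanishes, gives the relation.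
  have cocycle : ∀ d y z, f d y + f (d + y) z + f d (y + z) = f y z := by
    intro d y z
    obtain ⟨c, rfl⟩ := half d
    have h1 := sign_defect_symm hr hB c c y z
    have h2 := sign_defect_symm hr hB 0 0 y z
    simp only [sub_self, zero_sub, zero_add, hl, add_zero] at h1 h2
    rw [← h1, h2]
  have trans : ∀ g : A → ZMod 2, ∀ y, ∑ c, g (c + y) = ∑ c, g c := fun g y =>
    Equiv.sum_comp (Equiv.addRight y) g
  -- By the Bol condition with z = 0, the sum for a double y + y is twice the sum for y, and every
  -- element is a double.
  have hu : ∀ y, ∑ c, f c y = 0 := by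
    intro d
    obtain ⟨y, rfl⟩ := half d
    have h : ∑ c, f c (y + 0 + y) = ∑ c, (f c y + f (c + y) 0 + f (c + y + 0) y) :=
      Finset.sum_congr rfl fun c _ => hB c y 0
    simp only [hr, add_zero, Finset.sum_add_distrib] at h
    rw [h, trans (fun c => f c y) y]
    exact CharTwo.add_self_eq_zero _
  -- Summing the relation over d kills the left side and leaves |A| · f y z = 0 with |A| odd.
  have h : ∑ d, (f d y + f (d + y) z + f d (y + z)) = ∑ _d : A, f y z :=
    Finset.sum_congr rfl fun d _ => cocycle d y z
  rw [Finset.sum_add_distrib, Finset.sum_add_distrib, trans (fun c => f c z) y, hu, hu, hu,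
    Finset.sum_const, Finset.card_univ, ← Nat.card_eq_fintype_card, nsmul_eq_mul,
    (ZMod.natCast_eq_one_iff_odd).2 hA] at h
  simpa using h.symm

end Sign

/-! ### Powers and right translations in right Bol loops -/

section RightBol

variable {Q : Type*} [Loop Q]

@[simp]
theorem rightTrans_apply (x y : Q) : rightTrans x y = y * x := rfl

theorem rightTrans_injective : Function.Injective (rightTrans : Q → Equiv.Perm Q) := by
  intro x y h
  simpa using congrArg (fun g : Equiv.Perm Q => g 1) h

theorem mul_left_cancel_loop {x y z : Q} (h : x * y = x * z) : y = z :=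
  (leftTrans x).injective h

theorem mul_right_cancel_loop {x y z : Q} (h : y * x = z * x) : y = z :=
  (rightTrans x).injective h

theorem rightTrans_one : rightTrans (1 : Q) = 1 := by
  ext x
  exact mul_one x

theorem rightTrans_bol (hQ : IsRightBol Q) (y z : Q) :
    rightTrans y * rightTrans z * rightTrans y = rightTrans ((y * z) * y) := by
  ext x
  exact hQ x y z

/-- The powers of a right translation are the right translations by powers. -/
theorem rightTrans_pow (hQ : IsRightBol Q) (x : Q) (n : ℕ) :
    rightTrans ((rightTrans x ^ n) 1) = rightTrans x ^ n := by
  induction n using Nat.twoStepInduction with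
  | zero => exact rightTrans_one
  | one => simp
  | more n ih _ =>
    have h := rightTrans_bol hQ x ((rightTrans x ^ n) 1)
    have e : x * (rightTrans x ^ n) 1 = (rightTrans x ^ (n + 1)) 1 := by
      rw [← rightTrans_apply, ih, pow_succ, Equiv.Perm.mul_apply, rightTrans_apply, one_mul]
    rw [e, ih] at h
    rw [pow_succ', pow_succ, ← mul_assoc, h, rightTrans_apply, one_mul]

theorem mul_pow_apply (hQ : IsRightBol Q) (a x : Q) (n : ℕ) :
    a * (rightTrans x ^ n) 1 = (rightTrans x ^ n) a := by
  rw [← rightTrans_apply, rightTrans_pow hQ]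

/-- R_x^n is the translation by x^n, so a fixed point a gives a · x^n = a and x^n = 1. Thus the
group generated by R_x acts freely. -/
theorem rightTrans_pow_eq_one (hQ : IsRightBol Q) {x a : Q} {n : ℕ}
    (h : (rightTrans x ^ n) a = a) : rightTrans x ^ n = 1 := by
  rw [← mul_pow_apply hQ] at h
  rw [← rightTrans_pow hQ, mul_left_cancel_loop (h.trans (mul_one a).symm), rightTrans_one]

theorem map_pow_apply {C : Type*} [Monoid C] (π : Q →* C) (x : Q) (n : ℕ) (a : Q) :
    π ((rightTrans x ^ n) a) = π a * π x ^ n := by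
  induction n with
  | zero => simp
  | succ n ih => rw [pow_succ', Equiv.Perm.mul_apply, rightTrans_apply, map_mul, ih, pow_succ,
      mul_assoc]

theorem mem_center_iff {x : Q} :
    x ∈ center Q ↔ (∀ y, x * y = y * x) ∧ (∀ y z, x * (y * z) = (x * y) * z) ∧
      (∀ y z, y * (x * z) = (y * x) * z) ∧ ∀ y z, y * (z * x) = (y * z) * x := by
  simp only [center, nucleus, leftNucleus, middleNucleus, rightNucleus, commutant,
    Set.mem_inter_iff, Set.mem_ofPred_eq]
  tauto

theorem mul_mem_center {z w : Q} (hz : z ∈ center Q) (hw : w ∈ center Q) : z * w ∈ center Q := by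
  rw [mem_center_iff] at *
  refine ⟨fun y => ?_, fun y t => ?_, fun y t => ?_, fun y t => ?_⟩
  · rw [← hz.2.1, hw.1, hz.2.1, hz.1, ← hw.2.2.2]
  · rw [← hz.2.1, ← hz.2.1, ← hz.2.1, hw.2.1]
  · rw [← hz.2.1, hz.2.2.1, hw.2.2.1, ← hw.2.2.2]
  · rw [hw.2.2.2, hw.2.2.2, hz.2.2.2, ← hw.2.2.2]

theorem isAbelianGroup_of_pow_mul_center (hQ : IsRightBol Q) (x : Q)
    (h : ∀ q, ∃ n : ℕ, ∃ z ∈ center Q, q = (rightTrans x ^ n) 1 * z) : IsAbelianGroup Q := by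
  have hadd : ∀ m n : ℕ,
      (rightTrans x ^ m) 1 * (rightTrans x ^ n) 1 = (rightTrans x ^ (m + n)) 1 := by
    intro m n
    rw [mul_pow_apply hQ, ← Equiv.Perm.mul_apply, ← pow_add, add_comm]
  have hmul : ∀ a b z w : Q, z ∈ center Q → w ∈ center Q →
      (a * z) * (b * w) = (a * b) * (z * w) := by
    intro a b z w hz hw
    rw [mem_center_iff] at hz hw
    rw [hw.2.2.2, ← hz.2.2.1, hz.1, hz.2.2.2, ← hw.2.2.2]
  constructor
  · intro a b c
    obtain ⟨i, z, hz, rfl⟩ := h a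
    obtain ⟨j, w, hw, rfl⟩ := h b
    obtain ⟨k, t, ht, rfl⟩ := h c
    rw [hmul _ _ _ _ hz hw, hmul _ _ _ _ (mul_mem_center hz hw) ht, hmul _ _ _ _ hw ht,
      hmul _ _ _ _ hz (mul_mem_center hw ht), hadd, hadd, hadd, hadd, add_assoc,
      (mem_center_iff.1 hz).2.1]
  · intro a b
    obtain ⟨i, z, hz, rfl⟩ := h a
    obtain ⟨j, w, hw, rfl⟩ := h b
    rw [hmul _ _ _ _ hz hw, hmul _ _ _ _ hw hz, hadd, hadd, add_comm,
      (mem_center_iff.1 hz).1]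

/-- A right Bol loop with a cyclic quotient by a central subloop is an abelian group. -/
theorem isAbelianGroup_of_isCyclic (hQ : IsRightBol Q) {C : Type*} [CommGroup C] [Finite C]
    [IsCyclic C] (π : Q →* C) (hπ : Function.Surjective π) (hker : ∀ q, π q = 1 → q ∈ center Q) :
    IsAbelianGroup Q := by
  obtain ⟨g, hg⟩ := IsCyclic.exists_generator (α := C)
  obtain ⟨x, rfl⟩ := hπ g
  refine isAbelianGroup_of_pow_mul_center hQ x fun q => ?_
  obtain ⟨n, hn⟩ := mem_powers_iff_mem_zpowers.2 (hg (π q))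
  refine ⟨n, Loop.ldiv ((rightTrans x ^ n) 1) q, hker _ ?_, (Loop.mul_ldiv _ _).symm⟩
  have h := congrArg π (Loop.mul_ldiv ((rightTrans x ^ n) 1) q)
  rw [map_mul, map_pow_apply, map_one, one_mul, ← hn] at h
  exact mul_eq_left.1 h

end RightBol

/-! ### Right Bol loops of order nine -/

section OrderNine

variable {Q : Type*} [Loop Q]

theorem orderOf_rightTrans_dvd_card [Finite Q] (hQ : IsRightBol Q) (x : Q) :
    orderOf (rightTrans x) ∣ Nat.card Q := by
  have hfree : ∀ a : Q, MulAction.stabilizer (Subgroup.zpowers (rightTrans x)) a = ⊥ := by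
    intro a
    rw [eq_bot_iff]
    rintro ⟨g, hg⟩ ha
    obtain ⟨n, rfl⟩ := mem_powers_iff_mem_zpowers.2 hg
    have : (rightTrans x ^ n) a = a := ha
    simpa [Subgroup.mem_bot, Subtype.ext_iff] using rightTrans_pow_eq_one hQ this
  rw [Nat.card_congr (MulAction.selfEquivOrbitsQuotientProd hfree), Nat.card_prod,
    Nat.card_zpowers]
  exact dvd_mul_left _ _

/-- `x` is not the identity and `y` is not a power of `x`. -/
def Independent (x y : Q) : Prop := x ≠ 1 ∧ ∀ k : ℕ, rightTrans y ≠ rightTrans x ^ k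

theorem rightTrans_sq (hQ : IsRightBol Q) (x : Q) : rightTrans (x * x) = rightTrans x ^ 2 := by
  rw [← rightTrans_pow hQ x 2, pow_two, Equiv.Perm.mul_apply, rightTrans_apply, rightTrans_apply,
    one_mul]

theorem rightTrans_ne_one {x : Q} (hx : x ≠ 1) : rightTrans x ≠ 1 := by
  rw [← rightTrans_one]
  exact fun h => hx (rightTrans_injective h)

theorem Independent.symm (hE : ∀ x : Q, rightTrans x ^ 3 = 1) {x y : Q} (h : Independent x y) :
    Independent y x := by
  refine ⟨fun hy => h.2 0 (by rw [hy, rightTrans_one, pow_zero]), fun k hk => ?_⟩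
  have h3 : (rightTrans y ^ k) = rightTrans y ^ (k % 3) := pow_eq_pow_mod k (hE y)
  have hlt : k % 3 < 3 := Nat.mod_lt _ (by norm_num)
  rw [h3] at hk
  interval_cases k % 3
  · exact rightTrans_ne_one h.1 (by simpa using hk)
  · exact h.2 1 (by simpa using hk.symm)
  · refine h.2 2 ?_
    rw [hk, ← pow_mul]
    exact (pow_eq_pow_mod 4 (hE y)).symm ▸ (pow_one _).symm

theorem Independent.sq_left (hQ : IsRightBol Q) (hE : ∀ x : Q, rightTrans x ^ 3 = 1) {x y : Q}
    (h : Independent x y) : Independent (x * x) y := by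
  refine ⟨fun hx => ?_, fun k hk => h.2 (2 * k) ?_⟩
  · have h2 : rightTrans x ^ 2 = 1 := by rw [← rightTrans_sq hQ, hx, rightTrans_one]
    have h3 := hE x
    rw [pow_succ, h2, one_mul] at h3
    exact rightTrans_ne_one h.1 h3
  · rw [hk, rightTrans_sq hQ, pow_mul]

/-- The nine products y^j x^i are distinct, since a coincidence with different j would make y a
power of x; hence they exhaust the loop. -/
theorem Independent.span (hQ : IsRightBol Q) (hcard : Nat.card Q = 9)
    (hE : ∀ x : Q, rightTrans x ^ 3 = 1) {x y : Q} (h : Independent x y) (q : Q) :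
    ∃ i < 3, ∃ j < 3, q = (rightTrans x ^ i) ((rightTrans y ^ j) 1) := by
  have : Finite Q := Nat.finite_of_card_ne_zero (by omega)
  let F : Fin 3 × Fin 3 → Q := fun p =>
    (rightTrans x ^ (p.1 : ℕ)) ((rightTrans y ^ (p.2 : ℕ)) 1)
  have hinj : Function.Injective F := by
    rintro ⟨i, j⟩ ⟨i', j'⟩ heq
    have heq : (rightTrans x ^ (i : ℕ)) ((rightTrans y ^ (j : ℕ)) 1) =
      (rightTrans x ^ (i' : ℕ)) ((rightTrans y ^ (j' : ℕ)) 1) := heq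
    have h1 : (rightTrans y ^ (j : ℕ)) 1 =
        (rightTrans x ^ (3 - (i : ℕ) + i')) ((rightTrans y ^ (j' : ℕ)) 1) := by
      rw [pow_add, Equiv.Perm.mul_apply, ← heq, ← Equiv.Perm.mul_apply, ← pow_add,
        Nat.sub_add_cancel i.2.le, hE, Equiv.Perm.one_apply]
    have h2 : (rightTrans y ^ ((j : ℕ) + (3 - j'))) ((rightTrans y ^ (j' : ℕ)) 1) =
        (rightTrans x ^ (3 - (i : ℕ) + i')) ((rightTrans y ^ (j' : ℕ)) 1) := by
      rw [← h1, ← Equiv.Perm.mul_apply, ← pow_add, add_assoc, Nat.sub_add_cancel j'.2.le, pow_add,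
        hE, mul_one]
    rw [← mul_pow_apply hQ ((rightTrans y ^ (j' : ℕ)) 1) y,
      ← mul_pow_apply hQ ((rightTrans y ^ (j' : ℕ)) 1) x] at h2
    have h3 : rightTrans y ^ ((j : ℕ) + (3 - j')) = rightTrans x ^ (3 - (i : ℕ) + i') := by
      rw [← rightTrans_pow hQ, mul_left_cancel_loop h2, rightTrans_pow hQ]
    have hj : j = j' := by
      by_contra hne
      have hne' : (j : ℕ) ≠ j' := fun e => hne (Fin.ext e)
      -- An exponent prime to 3 has square 1 modulo 3, so raising `h3` to that exponent turns its
      -- left side into R_y.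
      have hsq : ∀ a < 3, ∀ b < 3, a ≠ b → ((a + (3 - b)) * (a + (3 - b))) % 3 = 1 := by decide
      have h4 := hsq j j.2 j' j'.2 hne'
      refine h.2 ((3 - (i : ℕ) + i') * ((j : ℕ) + (3 - j'))) ?_
      rw [pow_mul, ← h3, ← pow_mul, pow_eq_pow_mod _ (hE y), h4, pow_one]
    subst hj
    have h5 : rightTrans x ^ (3 - (i : ℕ) + i') = 1 := by
      rw [← h3, show (j : ℕ) + (3 - j) = 3 by omega, hE]
    have h6 : orderOf (rightTrans x) = 3 :=
      orderOf_eq_prime (hE x) (rightTrans_ne_one h.1)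
    have h7 := orderOf_dvd_of_pow_eq_one h5
    rw [h6] at h7
    have : i = i' := Fin.ext (by omega)
    rw [this]
  have hb : Function.Bijective F :=
    (Nat.bijective_iff_injective_and_card F).2 ⟨hinj, by simp [hcard]⟩
  obtain ⟨⟨i, j⟩, rfl⟩ := hb.2 q
  exact ⟨i, i.2, j, j.2, rfl⟩

/-- Equality would give R_y R_x R_y = R_x, so R_x would invert R_y by conjugation. Then so would
R_x³ = 1, forcing R_y² = 1 against R_y³ = 1. -/
theorem Independent.mul_mul_ne (hQ : IsRightBol Q) (hE : ∀ x : Q, rightTrans x ^ 3 = 1)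
    {x y : Q} (h : Independent x y) : (y * x) * y ≠ x := by
  intro heq
  have hb := rightTrans_bol hQ y x
  rw [heq] at hb
  have h1 : rightTrans x * rightTrans y = (rightTrans y)⁻¹ * rightTrans x := by
    rw [eq_inv_mul_iff_mul_eq, ← mul_assoc, hb]
  have h2 : rightTrans x * (rightTrans y)⁻¹ = rightTrans y * rightTrans x := by
    rw [mul_inv_eq_iff_eq_mul, hb]
  have h3 : rightTrans x ^ 3 * rightTrans y = (rightTrans y)⁻¹ * rightTrans x ^ 3 := by
    simp only [pow_succ, pow_zero, one_mul, mul_assoc]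
    rw [h1, ← mul_assoc (rightTrans x) (rightTrans y)⁻¹, h2, mul_assoc,
      ← mul_assoc (rightTrans x) (rightTrans y), h1, mul_assoc]
  rw [hE, one_mul, mul_one, eq_inv_iff_mul_eq_one, ← pow_two] at h3
  have h4 := hE y
  rw [pow_succ, h3, one_mul] at h4
  exact rightTrans_ne_one (h.symm hE).1 h4

/-- Equality would give (R_y R_x)² = R_x³ = 1. A permutation of nine points with square 1 fixes some
p, and (px)y = p yields x = y². -/
theorem Independent.mul_mul_ne_sq (hQ : IsRightBol Q) (hcard : Nat.card Q = 9)
    (hE : ∀ x : Q, rightTrans x ^ 3 = 1)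
    {x y : Q} (h : Independent x y) : (y * x) * y ≠ x * x := by
  intro heq
  have : Finite Q := Nat.finite_of_card_ne_zero (by omega)
  have := Fintype.ofFinite Q
  classical
  have hb := rightTrans_bol hQ y x
  rw [heq, rightTrans_sq hQ] at hb
  have h1 : (rightTrans y * rightTrans x) ^ 2 ^ 1 = 1 := by
    rw [pow_one, pow_two, ← mul_assoc, hb, ← pow_succ, hE]
  obtain ⟨p, hp⟩ := Equiv.Perm.exists_fixed_point_of_prime (p := 2) (n := 1)
    (by rw [← Nat.card_eq_fintype_card, hcard]; norm_num) h1
  have h2 : p * x = p * (y * y) := by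
    have h3 : (rightTrans y ^ 3) (p * x) = p * x := by rw [hE, Equiv.Perm.one_apply]
    rw [pow_succ, Equiv.Perm.mul_apply] at h3
    rw [← h3, ← rightTrans_apply (y * y), rightTrans_sq hQ]
    congr 1
  have h4 := mul_left_cancel_loop h2
  refine (h.symm hE).2 2 ?_
  rw [h4, rightTrans_sq hQ]

theorem Independent.mul_eq_or (hQ : IsRightBol Q) (hcard : Nat.card Q = 9)
    (hE : ∀ x : Q, rightTrans x ^ 3 = 1) {x y : Q} (h : Independent x y) :
    y * x = x * y ∨ y * x = (x * x) * y := by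
  have hs := h.symm hE
  obtain ⟨i, hi, j, hj, hq⟩ := hs.span hQ hcard hE (y * x)
  have hcube : ∀ a, ((a * y) * y) * y = a := fun a => by
    simpa [pow_succ] using congrArg (fun g : Equiv.Perm Q => g a) (hE y)
  have hyx : y ≠ x := fun e => h.2 1 (by rw [e, pow_one])
  -- Here yx = x^j y^i. If j = 0, then x is a power of y. Otherwise i = 0 fails by cancellation, and
  -- i = 2 gives (yx)y = x^j, excluded by the two preceding lemmas.
  interval_cases j
  · exfalso
    have h1 : y * x = y * (rightTrans y ^ (i + 2)) 1 := by
      rw [mul_pow_apply hQ, hq, pow_zero, Equiv.Perm.one_apply]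
      calc (rightTrans y ^ i) 1 = (rightTrans y ^ (i + 3)) 1 := by rw [pow_add, hE, mul_one]
        _ = _ := by
          rw [show i + 3 = i + 2 + 1 by rfl, pow_succ, Equiv.Perm.mul_apply, rightTrans_apply,
            one_mul]
    refine hs.2 (i + 2) ?_
    rw [mul_left_cancel_loop h1, rightTrans_pow hQ]
  · interval_cases i <;> simp [pow_succ] at hq
    · exact absurd (mul_right_cancel_loop (hq.trans (one_mul x).symm)) hs.1
    · exact Or.inl hq
    · exact absurd (by rw [hq, hcube]) (h.mul_mul_ne hQ hE)
  · interval_cases i <;> simp [pow_succ] at hq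
    · exact absurd (mul_right_cancel_loop hq) hyx
    · exact Or.inr hq
    · exact absurd (by rw [hq, hcube]) (h.mul_mul_ne_sq hQ hcard hE)

theorem Independent.mul_comm (hQ : IsRightBol Q) (hcard : Nat.card Q = 9)
    (hE : ∀ x : Q, rightTrans x ^ 3 = 1) {x y : Q} (h : Independent x y) :
    y * x = x * y := by
  have hcube : ∀ a, ((a * x) * x) * x = a := fun a => by
    simpa [pow_succ] using congrArg (fun g : Equiv.Perm Q => g a) (hE x)
  have hsq : ∀ a, a * (x * x) = (a * x) * x := fun a => by
    rw [← rightTrans_apply, rightTrans_sq hQ]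
    simp [pow_succ]
  have hs := h.symm hE
  have hyx : y ≠ x := fun e => h.2 1 (by rw [e, pow_one])
  rcases h.mul_eq_or hQ hcard hE with h1 | h1
  · exact h1
  rcases hs.mul_eq_or hQ hcard hE with h2 | h2
  · exact h2.symm
  exfalso
  -- Now yx = x²y and xy = y²x. For the pair x², y, either yx² = x²y = yx, so x = 1, or yx² = x⁴y =
  -- xy = y²x, so yx = y² and x = y.
  rcases (h.sq_left hQ hE).mul_eq_or hQ hcard hE with h3 | h3
  · rw [← h1] at h3
    have h4 := mul_left_cancel_loop h3
    exact h.1 (mul_left_cancel_loop (h4.trans (mul_one x).symm))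
  · rw [hsq (x * x), ← hsq, show (x * x) * (x * x) = x by rw [hsq, hcube], h2, hsq] at h3
    have h4 := mul_left_cancel_loop (mul_right_cancel_loop h3 : y * x = y * y)
    exact hyx h4.symm

theorem isAbelianGroup_of_card_nine (hQ : IsRightBol Q) (hcard : Nat.card Q = 9) :
    IsAbelianGroup Q := by
  have : Finite Q := Nat.finite_of_card_ne_zero (by omega)
  by_cases hc : ∃ x : Q, orderOf (rightTrans x) = 9
  · obtain ⟨x, hx⟩ := hc
    let F : Fin 9 → Q := fun i => (rightTrans x ^ (i : ℕ)) 1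
    have hinj : Function.Injective F := by
      intro i j hij
      have h1 : rightTrans x ^ (i : ℕ) = rightTrans x ^ (j : ℕ) := by
        rw [← rightTrans_pow hQ, ← rightTrans_pow hQ x j]
        exact congrArg rightTrans hij
      exact Fin.ext (pow_injOn_Iio_orderOf (by simp [hx]) (by simp [hx]) h1)
    have hb : Function.Bijective F :=
      (Nat.bijective_iff_injective_and_card F).2 ⟨hinj, by simp [hcard]⟩
    refine isAbelianGroup_of_pow_mul_center hQ x fun q => ?_
    obtain ⟨i, rfl⟩ := hb.2 q
    exact ⟨i, 1, by simp [mem_center_iff], (mul_one _).symm⟩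
  push Not at hc
  have hE : ∀ x : Q, rightTrans x ^ 3 = 1 := by
    intro x
    have h1 := orderOf_rightTrans_dvd_card hQ x
    rw [hcard, show 9 = 3 ^ 2 by norm_num, Nat.dvd_prime_pow Nat.prime_three] at h1
    obtain ⟨k, hk, h1⟩ := h1
    interval_cases k
    · exact orderOf_dvd_iff_pow_eq_one.1 (by simp [h1])
    · exact orderOf_dvd_iff_pow_eq_one.1 (by simp [h1])
    · exact absurd h1 (hc x)
  have dep : ∀ a b : Q, ¬ Independent a b → a = 1 ∨ ∃ k : ℕ, rightTrans b = rightTrans a ^ k := by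
    intro a b h
    unfold Independent at h
    push Not at h
    exact or_iff_not_imp_left.2 h
  have comm : ∀ a b : Q, a * b = b * a := by
    intro a b
    by_cases hab : Independent a b
    · exact (hab.mul_comm hQ hcard hE).symm
    rcases dep a b hab with rfl | ⟨k, hk⟩
    · simp
    · have h1 : rightTrans a * rightTrans b = rightTrans b * rightTrans a := by
        rw [hk, ← pow_succ, ← pow_succ']
      simpa using (congrArg (fun g : Equiv.Perm Q => g 1) h1).symm
  refine ⟨fun z a b => ?_, comm⟩
  -- Associativity means that the composite of two right translations is again a right translation.
  suffices h : ∃ w, rightTrans w = rightTrans b * rightTrans a by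
    obtain ⟨w, hw⟩ := h
    have h1 := congrArg (fun g : Equiv.Perm Q => g 1) hw
    simp only [rightTrans_apply, one_mul, Equiv.Perm.mul_apply] at h1
    rw [← h1, ← rightTrans_apply w, hw]
    rfl
  by_cases hab : Independent a b
  · have swap : ∀ i j : ℕ, (rightTrans a ^ i) ((rightTrans b ^ j) 1) =
        (rightTrans b ^ j) ((rightTrans a ^ i) 1) := by
      intro i j
      rw [← mul_pow_apply hQ, comm, mul_pow_apply hQ]
    have hcomm : Commute (rightTrans a) (rightTrans b) := by
      ext q
      obtain ⟨i, -, j, -, rfl⟩ := hab.span hQ hcard hE q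
      have h1 : rightTrans b ((rightTrans a ^ i) ((rightTrans b ^ j) 1)) =
          (rightTrans b ^ (j + 1)) ((rightTrans a ^ i) 1) := by
        rw [swap, pow_succ', Equiv.Perm.mul_apply]
      have h2 : ∀ u, rightTrans a ((rightTrans a ^ i) u) = (rightTrans a ^ (i + 1)) u := fun u => by
        rw [pow_succ', Equiv.Perm.mul_apply]
      rw [Equiv.Perm.mul_apply, Equiv.Perm.mul_apply, h1, ← swap, h2, h2, swap, swap, pow_succ',
        Equiv.Perm.mul_apply]
    -- Since R_a and R_b commute, R_{b²} R_a R_{b²} = R_b⁴ R_a = R_b R_a.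
    refine ⟨_, (rightTrans_bol hQ (b * b) a).symm.trans ?_⟩
    rw [rightTrans_sq hQ, mul_assoc, (hcomm.pow_right 2).eq, ← mul_assoc, ← pow_add,
      pow_succ, hE, one_mul]
  · rcases dep a b hab with rfl | ⟨k, hk⟩
    · exact ⟨b, by rw [rightTrans_one, mul_one]⟩
    · exact ⟨_, (rightTrans_pow hQ a (k + 1)).trans (by rw [hk, pow_succ])⟩

end OrderNine

/-! ### Preserving or reversing the orientation of orbits -/

section Twist

variable {Q : Type*}

/-- The exponent `1` or `-1` attached to a sign. -/
def twist (e : ZMod 2) : ℤ := if e = 0 then 1 else -1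

theorem twist_zero : twist 0 = 1 := rfl

theorem twist_add (e e' : ZMod 2) : twist (e + e') = twist e * twist e' := by
  revert e e'
  decide

/-- `g` maps the `ρ`-orbit of `x` to a `ρ`-orbit, preserving (`e = 0`) or reversing (`e = 1`)
its orientation. -/
def Twists (ρ g : Equiv.Perm Q) (x : Q) (e : ZMod 2) : Prop :=
  ∀ k : ℤ, g ((ρ ^ k) x) = (ρ ^ (twist e * k)) (g x)

variable {ρ g h : Equiv.Perm Q} {x : Q} {e e' : ZMod 2}

theorem Twists.comp (hh : Twists ρ h (g x) e') (hg : Twists ρ g x e) :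
    Twists ρ (h * g) x (e + e') := by
  intro k
  rw [Equiv.Perm.mul_apply, hg, hh, Equiv.Perm.mul_apply, twist_add, mul_left_comm, mul_assoc]

theorem Twists.shift (hg : Twists ρ g x e) (j : ℤ) : Twists ρ g ((ρ ^ j) x) e := by
  intro k
  rw [← Equiv.Perm.mul_apply (ρ ^ k), ← zpow_add, hg, hg, mul_add, zpow_add,
    Equiv.Perm.mul_apply]

theorem twists_pow (x : Q) (n : ℕ) : Twists ρ (ρ ^ n) x 0 := by
  intro k
  rw [twist_zero, one_mul, ← Equiv.Perm.mul_apply, ← Equiv.Perm.mul_apply, ← zpow_natCast,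
    ← zpow_add, ← zpow_add, add_comm]

theorem Twists.unique (h3 : ρ ^ 3 = 1) (hfree : ∀ y, ρ y ≠ y) (hg : Twists ρ g x e)
    (hg' : Twists ρ g x e') : e = e' := by
  have h1 := (hg 1).symm.trans (hg' 1)
  have hne : (ρ ^ (twist 0 * 1)) (g x) ≠ (ρ ^ (twist 1 * 1)) (g x) := by
    intro h2
    have h2 : (ρ ^ (1 : ℤ)) (g x) = (ρ ^ (-1 : ℤ)) (g x) := h2
    rw [zpow_one] at h2
    have h4 := congrArg (fun a => (ρ ^ 2) a) h2
    rw [← Equiv.Perm.mul_apply, ← pow_succ, h3, ← zpow_natCast,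
      ← Equiv.Perm.mul_apply _ (ρ ^ (-1 : ℤ)), ← zpow_add] at h4
    exact hfree _ (by simpa using h4.symm)
  have h01 : ∀ e : ZMod 2, e = 0 ∨ e = 1 := by decide
  rcases h01 e with rfl | rfl <;> rcases h01 e' with rfl | rfl
  · rfl
  · exact absurd h1 hne
  · exact absurd h1.symm hne
  · rfl

theorem twists_of_pow (h3 : ρ ^ 3 = 1) (h1 : g (ρ x) = (ρ ^ twist e) (g x))
    (h2 : g ((ρ ^ 2) x) = (ρ ^ (twist e * 2)) (g x)) : Twists ρ g x e := by
  have hz : ρ ^ (3 : ℤ) = 1 := by exact_mod_cast h3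
  intro k
  have hk : ρ ^ k = ρ ^ (k % 3) := by
    conv_lhs => rw [← Int.mul_ediv_add_emod k 3]
    rw [zpow_add, zpow_mul, hz, one_zpow, one_mul]
  have hk' : ρ ^ (twist e * k) = ρ ^ (twist e * (k % 3)) := by
    rw [mul_comm, zpow_mul, hk, ← zpow_mul, mul_comm]
  rw [hk, hk']
  have hlo := Int.emod_nonneg k (by norm_num : (3 : ℤ) ≠ 0)
  have hhi := Int.emod_lt_of_pos k (by norm_num : (0 : ℤ) < 3)
  interval_cases k % 3
  · simp
  · simpa using h1
  · exact_mod_cast h2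

end Twist

/-! ### Centrality of kernels of order three -/

section KernelOfOrderThree

variable {Q A : Type*} [Loop Q] [CommGroup A]

theorem exists_generator_of_card_ker (hQ : IsRightBol Q) (π : Q →* A)
    (hN : Nat.card {x // π x = 1} = 3) :
    ∃ n : Q, n ≠ 1 ∧ π n = 1 ∧ rightTrans n ^ 3 = 1 ∧
      ∀ x y, π x = π y → ∃ k : ℕ, y = (rightTrans n ^ k) x := by
  have hfin : {x | π x = 1}.Finite :=
    Set.finite_coe_iff.1 (Nat.finite_of_card_ne_zero (by exact hN ▸ by norm_num))
  have h3 : {x | π x = 1}.ncard = 3 := hN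
  have h2 : ({x | π x = 1} \ {1}).ncard = 2 := by
    rw [Set.ncard_sdiff_singleton_of_mem (by simp), h3]
  obtain ⟨n, m, hnm, hS⟩ := Set.ncard_eq_two.1 h2
  have mem : ∀ x, π x = 1 → x = 1 ∨ x = n ∨ x = m := by
    intro x hx
    by_cases h1 : x = 1
    · exact Or.inl h1
    · have : x ∈ ({n, m} : Set Q) := hS ▸ ⟨hx, h1⟩
      exact Or.inr this
  obtain ⟨hn, hn1⟩ : n ∈ {x | π x = 1} \ {1} := hS ▸ Or.inl rfl
  obtain ⟨hm, hm1⟩ : m ∈ {x | π x = 1} \ {1} := hS ▸ Or.inr rfl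
  have hn : π n = 1 := hn
  have hm : π m = 1 := hm
  have hn1 : n ≠ 1 := hn1
  have hm1 : m ≠ 1 := hm1
  have hnm_ne : n * m ≠ n := fun h => hm1 (mul_left_cancel_loop (h.trans (mul_one n).symm))
  have hnm_ne' : n * m ≠ m := fun h => hn1 (mul_right_cancel_loop (h.trans (one_mul m).symm))
  have hnn_ne : n * n ≠ n := fun h => hn1 (mul_left_cancel_loop (h.trans (mul_one n).symm))
  have hnm1 : n * m = 1 := by
    rcases mem (n * m) (by rw [map_mul, hn, hm, one_mul]) with h | h | h
    · exact h
    · exact absurd h hnm_ne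
    · exact absurd h hnm_ne'
  have hnn : n * n = m := by
    rcases mem (n * n) (by rw [map_mul, hn, one_mul]) with h | h | h
    · exact absurd (mul_left_cancel_loop (h.trans hnm1.symm)) hnm
    · exact absurd h hnn_ne
    · exact h
  have hcube : rightTrans n ^ 3 = 1 := by
    apply rightTrans_pow_eq_one hQ (a := 1)
    rw [pow_succ, Equiv.Perm.mul_apply, rightTrans_apply, one_mul, ← rightTrans_sq hQ, hnn,
      rightTrans_apply, hnm1]
  refine ⟨n, hn1, hn, hcube, fun x y hxy => ?_⟩
  have hd : π (Loop.ldiv x y) = 1 := by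
    have h := congrArg π (Loop.mul_ldiv x y)
    rwa [map_mul, ← hxy, mul_eq_left] at h
  have hy := (Loop.mul_ldiv x y).symm
  rcases mem _ hd with h | h | h <;> rw [h] at hy
  · exact ⟨0, by simpa using hy⟩
  · exact ⟨1, by simpa using hy⟩
  · exact ⟨2, by rw [hy, ← hnn, ← rightTrans_apply, rightTrans_sq hQ]⟩

/-- R_y maps a coset of three points onto a coset, and a bijection between two 3-cycles either
preserves or reverses the cyclic order. -/
theorem exists_twists {n : Q} (π : Q →* A) (h3 : rightTrans n ^ 3 = 1) (hn1 : n ≠ 1)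
    (hn : π n = 1) (hcos : ∀ x y, π x = π y → ∃ k : ℕ, y = (rightTrans n ^ k) x) (x y : Q) :
    ∃ e, Twists (rightTrans n) (rightTrans y) x e := by
  have hfree : ∀ a, rightTrans n a ≠ a := fun a h =>
    hn1 (mul_left_cancel_loop (h.trans (mul_one a).symm))
  have key : ∀ a, π a = π x → ∃ k < 3, rightTrans y a = (rightTrans n ^ k) (rightTrans y x) := by
    intro a ha
    obtain ⟨k, hk⟩ := hcos (rightTrans y x) (rightTrans y a) (by simp [ha])
    exact ⟨k % 3, Nat.mod_lt _ (by norm_num), by rw [hk, pow_eq_pow_mod k h3]⟩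
  obtain ⟨i, hi, h1⟩ := key (rightTrans n x) (by simp [hn])
  obtain ⟨j, hj, h2⟩ := key ((rightTrans n ^ 2) x) (by rw [map_pow_apply, hn, one_pow, mul_one])
  have hi0 : i ≠ 0 := by
    rintro rfl
    exact hfree x ((rightTrans y).injective (by simpa using h1))
  have hj0 : j ≠ 0 := by
    rintro rfl
    have h4 := (rightTrans y).injective (by simpa using h2 : _ = rightTrans y x)
    have h5 := congrArg (rightTrans n) h4
    rw [← Equiv.Perm.mul_apply, ← pow_succ', h3, Equiv.Perm.one_apply] at h5
    exact hfree x h5.symm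
  have hij : i ≠ j := by
    rintro rfl
    have h4 := (rightTrans y).injective (h1.trans h2.symm)
    rw [pow_two, Equiv.Perm.mul_apply] at h4
    exact hfree _ h4.symm
  have hz : rightTrans n ^ (3 : ℤ) = 1 := by exact_mod_cast h3
  interval_cases i
  · exact absurd rfl hi0
  · obtain rfl : j = 2 := by omega
    exact ⟨0, twists_of_pow h3 (by simpa [twist_zero] using h1) (by exact_mod_cast h2)⟩
  · obtain rfl : j = 1 := by omega
    refine ⟨1, twists_of_pow h3 ?_ ?_⟩
    · rw [h1, ← zpow_natCast]
      congr 1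
      calc rightTrans n ^ (2 : ℤ) = rightTrans n ^ (-1 : ℤ) * rightTrans n ^ (3 : ℤ) := by
            rw [← zpow_add]; norm_num
        _ = _ := by rw [hz, mul_one]; rfl
    · rw [h2, ← zpow_natCast]
      congr 1
      calc rightTrans n ^ (1 : ℤ) = rightTrans n ^ (-2 : ℤ) * rightTrans n ^ (3 : ℤ) := by
            rw [← zpow_add]; norm_num
        _ = _ := by rw [hz, mul_one]; rfl

/-- A reversal would give (ny)n = y, so R_y would invert R_n by conjugation, and so would its odd
power R_y^|A|. But y^|A| lies in the kernel, so that power is a power of R_n and commutes with R_n,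
forcing R_n² = 1. -/
theorem twists_one [Finite A] (hA : Odd (Nat.card A)) (hQ : IsRightBol Q) {n : Q} (π : Q →* A)
    (h3 : rightTrans n ^ 3 = 1) (hn1 : n ≠ 1)
    (hn : π n = 1) (hcos : ∀ x y, π x = π y → ∃ k : ℕ, y = (rightTrans n ^ k) x) (y : Q) :
    Twists (rightTrans n) (rightTrans y) 1 0 := by
  obtain ⟨e, he⟩ := exists_twists π h3 hn1 hn hcos 1 y
  by_cases h0 : e = 0
  · exact h0 ▸ he
  exfalso
  have h1 := he 1
  have h2 : (n * y) * n = y := by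
    simp only [twist, h0, if_false, zpow_one, mul_one, rightTrans_apply, one_mul] at h1
    rw [h1, ← rightTrans_apply n, zpow_neg_one]
    exact (rightTrans n).apply_symm_apply y
  have h4 := rightTrans_bol hQ n y
  rw [h2] at h4
  have s1 : SemiconjBy (rightTrans y) (rightTrans n) (rightTrans n)⁻¹ := by
    rw [SemiconjBy, eq_inv_mul_iff_mul_eq, ← mul_assoc, h4]
  have s2 : Commute (rightTrans y ^ 2) (rightTrans n) := by
    have := s1.inv_right
    rw [inv_inv] at this
    rw [pow_two]
    exact this.mul_left s1
  obtain ⟨k, hk⟩ := hA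
  have s3 : SemiconjBy (rightTrans y ^ Nat.card A) (rightTrans n) (rightTrans n)⁻¹ := by
    rw [hk, pow_succ', pow_mul]
    exact s1.mul_left (s2.pow_left k)
  obtain ⟨j, hj⟩ := hcos 1 ((rightTrans y ^ Nat.card A) 1)
    (by rw [map_pow_apply, pow_card_eq_one', map_one, one_mul])
  rw [← rightTrans_pow hQ, hj, rightTrans_pow hQ, SemiconjBy, ((Commute.refl _).pow_left j).eq,
    mul_left_inj, eq_inv_iff_mul_eq_one, ← pow_two] at s3
  rw [pow_succ, s3, one_mul] at h3
  exact rightTrans_ne_one hn1 h3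

/-- Let `A` be an abelian group of odd order. If the kernel of a surjective homomorphism from
a right Bol loop to `A` has order three, then it is central. -/
theorem mem_center_of_card_ker [Finite A] (hA : Odd (Nat.card A)) (hQ : IsRightBol Q)
    (π : Q →* A) (hπ : Function.Surjective π) (hN : Nat.card {x // π x = 1} = 3) {q : Q}
    (hq : π q = 1) : q ∈ center Q := by
  obtain ⟨n, hn1, hn, h3, hcos⟩ := exists_generator_of_card_ker hQ π hN
  have hfree : ∀ a, rightTrans n a ≠ a := fun a h =>
    hn1 (mul_left_cancel_loop (h.trans (mul_one a).symm))
  have hone := twists_one hA hQ π h3 hn1 hn hcos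
  choose σ hσ using exists_twists π h3 hn1 hn hcos
  choose sec hsec using hπ
  have hpow : ∀ (k : ℕ) (y : Q), rightTrans ((rightTrans n ^ (2 * k)) y) =
      rightTrans n ^ k * rightTrans y * rightTrans n ^ k := by
    intro k y
    have h1 := rightTrans_bol hQ ((rightTrans n ^ k) 1) y
    have h2 : (rightTrans n ^ k) 1 * y = (rightTrans n ^ k) y := by
      have := hone y k
      simpa [twist_zero] using this
    rw [rightTrans_pow hQ, h2, mul_pow_apply hQ, ← Equiv.Perm.mul_apply, ← pow_add,
      ← two_mul] at h1
    exact h1.symm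
  -- The sign depends only on cosets: replacing y by y · n^j multiplies R_y on both sides by
  -- R_n^(2j), as 2 · 2j ≡ j modulo 3, and powers of R_n preserve orientation.
  have htw : ∀ x y, Twists (rightTrans n) (rightTrans y) x (σ (sec (π x)) (sec (π y))) := by
    intro x y
    obtain ⟨j, hj⟩ := hcos (sec (π y)) y (hsec _)
    obtain ⟨i, hi⟩ := hcos (sec (π x)) x (hsec _)
    have h4 : rightTrans y =
        rightTrans n ^ (2 * j) * rightTrans (sec (π y)) * rightTrans n ^ (2 * j) := by
      rw [← hpow, show 2 * (2 * j) = 3 * j + j by ring, pow_add, pow_mul, h3, one_pow, one_mul,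
        ← hj]
    have h5 := (hσ (sec (π x)) (sec (π y))).shift (i + (2 * j : ℕ))
    have h6 : (rightTrans n ^ ((i : ℤ) + (2 * j : ℕ))) (sec (π x)) =
        (rightTrans n ^ (2 * j)) x := by
      rw [add_comm, zpow_add, Equiv.Perm.mul_apply, zpow_natCast, zpow_natCast, ← hi]
    rw [h6] at h5
    have h7 := (twists_pow (ρ := rightTrans n) _ (2 * j)).comp (h5.comp (twists_pow x (2 * j)))
    rw [zero_add, add_zero, ← mul_assoc, ← h4] at h7
    exact h7
  have hzero : ∀ c d : Additive A, σ (sec c.toMul) (sec d.toMul) = 0 := by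
    refine sign_eq_zero (A := Additive A) (f := fun c d => σ (sec c.toMul) (sec d.toMul))
      hA ?_ ?_ ?_
    · intro d
      refine Twists.unique h3 hfree ?_ (hone (sec d.toMul))
      have := htw 1 (sec d.toMul)
      rwa [hsec, map_one] at this
    · intro c
      refine Twists.unique h3 hfree (x := sec c.toMul) (g := rightTrans 1) ?_ ?_
      · have := htw (sec c.toMul) 1
        rwa [hsec, map_one] at this
      · have := twists_pow (ρ := rightTrans n) (sec c.toMul) 0
        rwa [pow_zero, ← rightTrans_one] at this
    · intro c y z
      obtain ⟨a, ha⟩ : ∃ a, π a = c.toMul := ⟨_, hsec _⟩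
      obtain ⟨u, hu⟩ : ∃ a, π a = y.toMul := ⟨_, hsec _⟩
      obtain ⟨v, hv⟩ : ∃ a, π a = z.toMul := ⟨_, hsec _⟩
      have h1 := (htw ((a * u) * v) u).comp ((htw (a * u) v).comp (htw a u))
      rw [← mul_assoc, rightTrans_bol hQ] at h1
      have h2 := Twists.unique h3 hfree (htw a ((u * v) * u)) h1
      simpa only [map_mul, ha, hu, hv, toMul_add] using h2
  have hcomm : ∀ (k : ℕ) (x y : Q),
      (x * (rightTrans n ^ k) 1) * y = (x * y) * (rightTrans n ^ k) 1 := by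
    intro k x y
    have h1 := htw x y k
    have h2 : σ (sec (π x)) (sec (π y)) = 0 := hzero (Additive.ofMul _) (Additive.ofMul _)
    rw [h2, twist_zero, one_mul, zpow_natCast] at h1
    rw [mul_pow_apply hQ, mul_pow_apply hQ]
    exact h1
  obtain ⟨k, hk⟩ := hcos 1 q (by rw [hq, map_one])
  have hR : ∀ x y, (x * q) * y = (x * y) * q := hk ▸ hcomm k
  have hc : ∀ y, q * y = y * q := fun y => by simpa using hR 1 y
  -- For the square root p of q in the kernel, p commutes past all factors, so the Bol identity
  -- ((yp)z)p = y((pz)p) reads (yz)q = y(zq).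
  have hr : ∀ y z, y * (z * q) = (y * z) * q := by
    intro y z
    set p := (rightTrans n ^ (2 * k)) 1 with hp
    have hpp : rightTrans p * rightTrans p = rightTrans q := by
      rw [hp, rightTrans_pow hQ, hk, rightTrans_pow hQ, ← pow_add,
        show 2 * k + 2 * k = 3 * k + k by ring, pow_add, pow_mul, h3, one_pow, one_mul]
    have hpp' : ∀ a, (a * p) * p = a * q := fun a => by
      simpa using congrArg (fun g : Equiv.Perm Q => g a) hpp
    have h1 := hQ y p z
    have h2 : ∀ x y, (x * p) * y = (x * y) * p := hcomm (2 * k)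
    have h4 : p * z = z * p := by simpa using h2 1 z
    rw [h2, hpp', h4, hpp'] at h1
    exact h1.symm
  refine mem_center_iff.2 ⟨hc, fun y z => ?_, fun y z => ?_, hr⟩
  · rw [hc, hc, hR]
  · rw [hc, hr, hR]

end KernelOfOrderThree

/-! ### From right Bol to left Bol loops -/

section Opposite

open MulOpposite

variable {Q : Type*} [Loop Q]

/-- The opposite loop. -/
instance oppositeLoop : Loop Qᵐᵒᵖ where
  ldiv x y := op (Loop.rdiv y.unop x.unop)
  rdiv x y := op (Loop.ldiv y.unop x.unop)
  mul_ldiv x y := unop_injective (Loop.rdiv_mul y.unop x.unop)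
  ldiv_mul x y := unop_injective (Loop.mul_rdiv y.unop x.unop)
  mul_rdiv x y := unop_injective (Loop.ldiv_mul y.unop x.unop)
  rdiv_mul x y := unop_injective (Loop.mul_ldiv y.unop x.unop)

theorem IsLeftBol.opposite (h : IsLeftBol Q) : IsRightBol Qᵐᵒᵖ :=
  fun x y z => unop_injective (h x.unop y.unop z.unop)

theorem op_mem_center_iff {x : Q} : op x ∈ center Qᵐᵒᵖ ↔ x ∈ center Q := by
  simp only [mem_center_iff, MulOpposite.forall, ← op_mul, op_inj]
  constructor
  · rintro ⟨h1, h2, h3, h4⟩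
    exact ⟨fun y => (h1 y).symm, fun y z => (h4 z y).symm, fun y z => (h3 z y).symm,
      fun y z => (h2 z y).symm⟩
  · rintro ⟨h1, h2, h3, h4⟩
    exact ⟨fun y => (h1 y).symm, fun y z => (h4 z y).symm, fun y z => (h3 z y).symm,
      fun y z => (h2 z y).symm⟩

theorem IsAbelianGroup.of_opposite (h : IsAbelianGroup Qᵐᵒᵖ) : IsAbelianGroup Q :=
  ⟨fun x y z => op_injective (h.1 (op z) (op y) (op x)).symm,
    fun x y => op_injective (h.2 (op y) (op x))⟩

/-- A homomorphism to a commutative group, seen as a homomorphism on the opposite loop. -/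
def oppositeHom {A : Type*} [CommGroup A] (π : Q →* A) : Qᵐᵒᵖ →* A where
  toFun x := π x.unop
  map_one' := map_one π
  map_mul' x y := by rw [unop_mul, map_mul, mul_comm]

theorem oppositeHom_surjective {A : Type*} [CommGroup A] {π : Q →* A}
    (hπ : Function.Surjective π) : Function.Surjective (oppositeHom π) := fun a =>
  let ⟨x, hx⟩ := hπ a
  ⟨op x, hx⟩

theorem IsBol.isAbelianGroup_of_card_nine (hQ : IsBol Q) (hcard : Nat.card Q = 9) :
    IsAbelianGroup Q := by
  rcases hQ with hQ | hQ
  · exact LoopTheory.isAbelianGroup_of_card_nine hQ hcard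
  · exact (LoopTheory.isAbelianGroup_of_card_nine hQ.opposite
      ((Nat.card_congr opEquiv.symm).trans hcard)).of_opposite

theorem IsBol.isAbelianGroup_of_isCyclic (hQ : IsBol Q) {C : Type*} [CommGroup C] [Finite C]
    [IsCyclic C] (π : Q →* C) (hπ : Function.Surjective π) (hker : ∀ q, π q = 1 → q ∈ center Q) :
    IsAbelianGroup Q := by
  rcases hQ with hQ | hQ
  · exact LoopTheory.isAbelianGroup_of_isCyclic hQ π hπ hker
  · exact (LoopTheory.isAbelianGroup_of_isCyclic hQ.opposite (oppositeHom π)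
      (oppositeHom_surjective hπ) fun q hq => op_mem_center_iff.2 (hker q.unop hq)).of_opposite

theorem IsBol.mem_center_of_card_ker {A : Type*} [CommGroup A] [Finite A]
    (hA : Odd (Nat.card A)) (hQ : IsBol Q)
    (π : Q →* A) (hπ : Function.Surjective π) (hN : Nat.card {x // π x = 1} = 3) {q : Q}
    (hq : π q = 1) : q ∈ center Q := by
  rcases hQ with hQ | hQ
  · exact LoopTheory.mem_center_of_card_ker hA hQ π hπ hN hq
  · refine op_mem_center_iff.1 (LoopTheory.mem_center_of_card_ker hA hQ.opposite (oppositeHom π)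
      (oppositeHom_surjective hπ) ?_ hq)
    exact (Nat.card_congr (opEquiv.symm.subtypeEquiv fun _ => Iff.rfl)).trans hN

end Opposite

/-! ### Factor loops as homomorphic images -/

section Factor

variable {Q : Type*} [Loop Q]

theorem IsBol.factor (hQ : IsBol Q) (N : Subloop Q) [N.Normal] : IsBol N.Factor := by
  rcases hQ with hQ | hQ
  · left
    rintro ⟨x⟩ ⟨y⟩ ⟨z⟩
    exact congrArg (Quotient.mk N.cosetSetoid) (hQ x y z)
  · right
    rintro ⟨x⟩ ⟨y⟩ ⟨z⟩
    exact congrArg (Quotient.mk N.cosetSetoid) (hQ x y z)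

/-- The projection to the factor loop. -/
def Subloop.mkHom (N : Subloop Q) [N.Normal] : Q →* N.Factor where
  toFun := Quotient.mk N.cosetSetoid
  map_one' := rfl
  map_mul' _ _ := rfl

theorem Subloop.mkHom_eq_iff (N : Subloop Q) [N.Normal] (x y : Q) :
    N.mkHom x = N.mkHom y ↔ Loop.ldiv x y ∈ N.carrier := by
  rw [← N.coset_eq_iff]
  exact Quotient.eq (r := N.cosetSetoid)

theorem Subloop.mkHom_eq_one_iff (N : Subloop Q) [N.Normal] (x : Q) :
    N.mkHom x = 1 ↔ x ∈ N.carrier := by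
  rw [eq_comm, ← map_one N.mkHom, N.mkHom_eq_iff]
  have : Loop.ldiv 1 x = x := by simpa using Loop.ldiv_mul 1 x
  rw [this]

theorem Subloop.mkHom_surjective (N : Subloop Q) [N.Normal] : Function.Surjective N.mkHom :=
  Quotient.mk_surjective

theorem Subloop.card_eq_card_factor_mul (N : Subloop Q) [N.Normal] :
    Nat.card Q = Nat.card N.Factor * Nat.card N.carrier := by
  rw [← Nat.card_prod]
  let s := Function.surjInv N.mkHom_surjective
  have hs : ∀ c, N.mkHom (s c) = c := Function.surjInv_eq N.mkHom_surjective
  have hmul : ∀ c (n : N.carrier), N.mkHom (s c * n) = c := fun c n => by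
    rw [map_mul, hs, (N.mkHom_eq_one_iff _).2 n.2, mul_one]
  refine (Nat.card_congr (Equiv.ofBijective (fun p : N.Factor × N.carrier => s p.1 * (p.2 : Q))
    ⟨?_, fun q => ?_⟩)).symm
  · rintro ⟨c, n⟩ ⟨d, m⟩ h
    have h : s c * (n : Q) = s d * (m : Q) := h
    obtain rfl : c = d := by rw [← hmul c n, h, hmul]
    rw [Subtype.ext (mul_left_cancel_loop h)]
  · exact ⟨⟨N.mkHom q, ⟨Loop.ldiv (s (N.mkHom q)) q, (N.mkHom_eq_iff _ _).1 (hs _)⟩⟩,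
      Loop.mul_ldiv _ _⟩

/-- The group structure on a loop that is an abelian group. -/
@[reducible]
def IsAbelianGroup.commGroup (h : IsAbelianGroup Q) : CommGroup Q :=
  { (inferInstance : MulOneClass Q) with
    mul_assoc := h.1
    mul_comm := h.2
    inv := fun x => Loop.ldiv x 1
    inv_mul_cancel := fun x => (h.2 _ _).trans (Loop.mul_ldiv x 1) }

theorem Subloop.HasAbelianFactor.exists_hom.{u} {Q : Type u} [Loop Q] {N : Subloop Q}
    (hN : N.HasAbelianFactor) :
    ∃ (A : Type u) (_ : CommGroup A) (π : Q →* A), Function.Surjective π ∧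
      (∀ x, π x = 1 ↔ x ∈ N.carrier) ∧ Nat.card Q = Nat.card A * Nat.card N.carrier := by
  obtain ⟨_, hab⟩ := hN
  exact ⟨N.Factor, hab.commGroup, N.mkHom, N.mkHom_surjective, N.mkHom_eq_one_iff,
    N.card_eq_card_factor_mul⟩

end Factor

/-! ### The center as a normal subloop -/

section CenterSubloop

variable {Q : Type*} [Loop Q]

theorem one_mem_center : (1 : Q) ∈ center Q := by simp [mem_center_iff]

theorem ldiv_one_mem_center {z : Q} (hz : z ∈ center Q) : Loop.ldiv z 1 ∈ center Q := by
  set w := Loop.ldiv z 1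
  have hzw : z * w = 1 := Loop.mul_ldiv z 1
  rw [mem_center_iff] at *
  obtain ⟨h1, h2, h3, h4⟩ := hz
  have hwc : ∀ a, z * (w * a) = a := fun a => by rw [h2, hzw, one_mul]
  have hwr : ∀ a, z * (a * w) = a := fun a => by rw [h2, h1, ← h3, hzw, mul_one]
  refine ⟨fun y => ?_, fun y t => ?_, fun y t => ?_, fun y t => ?_⟩ <;>
    apply mul_left_cancel_loop (x := z)
  · rw [hwc, hwr]
  · rw [hwc, h2, hwc]
  · rw [h2, h1, ← h3, hwc, h2, hwr]
  · rw [hwr, h2, h1, ← h3, hwr]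

variable (Q) in
/-- The center as a subloop. -/
def centerSubloop : Subloop Q where
  carrier := center Q
  one_mem := one_mem_center
  mul_mem := mul_mem_center
  ldiv_mem {x y} hx hy := by
    have h : Loop.ldiv x y = Loop.ldiv x 1 * y := by
      apply mul_left_cancel_loop (x := x)
      rw [(mem_center_iff.1 hx).2.1, Loop.mul_ldiv, Loop.mul_ldiv, one_mul]
    rw [h]
    exact mul_mem_center (ldiv_one_mem_center hx) hy
  rdiv_mem {x y} hx hy := by
    have h : Loop.rdiv x y = Loop.ldiv y 1 * x := by
      apply mul_right_cancel_loop (x := y)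
      rw [Loop.rdiv_mul, ← (mem_center_iff.1 hy).1, (mem_center_iff.1 hy).2.1, Loop.mul_ldiv,
        one_mul]
    rw [h]
    exact mul_mem_center (ldiv_one_mem_center hy) hx

/-- Translations commute with multiplication by a central element. At x = 1 this shows that inner
mappings fix the center pointwise, so the center is normal. -/
theorem mlt_apply_mul {φ : Equiv.Perm Q} (hφ : φ ∈ mlt Q) {z : Q} (hz : z ∈ center Q) (x : Q) :
    φ (x * z) = φ x * z := by
  have hz' := mem_center_iff.1 hz
  induction hφ using Subgroup.closure_induction generalizing x with
  | mem g hg =>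
    rcases hg with ⟨a, rfl⟩ | ⟨a, rfl⟩
    · change (x * z) * a = (x * a) * z
      rw [← hz'.2.2.1, hz'.1, hz'.2.2.2]
    · exact hz'.2.2.2 a x
  | one => rfl
  | mul f g _ _ hf hg => rw [Equiv.Perm.mul_apply, hg, hf, Equiv.Perm.mul_apply]
  | inv g _ hg =>
    rw [Equiv.Perm.inv_eq_iff_eq, hg]
    exact congrArg (· * z) (g.apply_symm_apply x).symm

instance centerSubloop_normal : (centerSubloop Q).Normal where
  image_eq := by
    intro φ hφ
    have h : ∀ z ∈ center Q, φ z = z := by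
      intro z hz
      have h1 : φ 1 = 1 := hφ.2
      have h2 := mlt_apply_mul hφ.1 hz 1
      rwa [one_mul, h1, one_mul] at h2
    exact (Set.image_congr h).trans (Set.image_id' _)

/-- The trivial subloop. -/
def trivialSubloop (Q : Type*) [Loop Q] : Subloop Q where
  carrier := {1}
  one_mem := rfl
  mul_mem := by
    rintro _ _ rfl rfl
    exact one_mul 1
  ldiv_mem := by
    rintro _ _ rfl rfl
    exact (congrArg _ (one_mul 1).symm).trans (Loop.ldiv_mul 1 1)
  rdiv_mem := by
    rintro _ _ rfl rfl
    exact (congrArg (Loop.rdiv · 1) (one_mul 1).symm).trans (Loop.mul_rdiv 1 1)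

instance trivialSubloop_normal : (trivialSubloop Q).Normal where
  image_eq φ hφ := by
    have h1 : φ 1 = 1 := hφ.2
    exact (Set.image_singleton).trans (by rw [h1]; rfl)

theorem ldiv_eq_one_iff {x y : Q} : Loop.ldiv x y = 1 ↔ x = y := by
  constructor
  · intro h
    rw [← Loop.mul_ldiv x y, h, mul_one]
  · rintro rfl
    simpa using Loop.ldiv_mul x 1

theorem derivedSubloop_eq_one_iff : (derivedSubloop Q).carrier = {1} ↔ IsAbelianGroup Q := by
  constructor
  · intro h
    obtain ⟨_, hab⟩ := (derivedSubloop_isLeast (Q := Q)).1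
    rw [Subloop.isAbelianGroup_factor_iff, h] at hab
    exact ⟨fun x y z => ldiv_eq_one_iff.1 (hab.1 x y z), fun x y => ldiv_eq_one_iff.1 (hab.2 x y)⟩
  · intro h
    refine Set.Subset.antisymm ?_ (Set.singleton_subset_iff.2 (derivedSubloop Q).one_mem)
    refine derivedSubloop_isLeast.2 (trivialSubloop Q) ⟨inferInstance, ?_⟩
    rw [Subloop.isAbelianGroup_factor_iff]
    exact ⟨fun x y z => ldiv_eq_one_iff.2 (h.1 x y z), fun x y => ldiv_eq_one_iff.2 (h.2 x y)⟩

theorem IsAbelianGroup.center_eq_univ (h : IsAbelianGroup Q) : center Q = Set.univ :=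
  Set.eq_univ_of_forall fun x => mem_center_iff.2
    ⟨h.2 x, fun y z => (h.1 x y z).symm, fun y z => (h.1 y x z).symm, fun y z => (h.1 y z x).symm⟩

end CenterSubloop

/-! ### Bol loops of order 27 -/

section OrderTwentySeven

variable {Q : Type*} [Loop Q]

theorem center_eq_derivedSubloop_of_card_center (hQ : IsBol Q) (hcard : Nat.card Q = 27)
    (hZ : Nat.card (center Q) = 3) : center Q = (derivedSubloop Q).carrier := by
  have : Finite Q := Nat.finite_of_card_ne_zero (by omega)
  have h9 : Nat.card (centerSubloop Q).Factor = 9 := by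
    have h := (centerSubloop Q).card_eq_card_factor_mul
    have hZ' : Nat.card (centerSubloop Q).carrier = 3 := hZ
    rw [hcard, hZ'] at h
    omega
  have hsub : (derivedSubloop Q).carrier ⊆ center Q :=
    derivedSubloop_isLeast.2 (centerSubloop Q)
      ⟨inferInstance, (hQ.factor _).isAbelianGroup_of_card_nine h9⟩
  refine (Set.eq_of_subset_of_ncard_le hsub ?_).symm
  -- |Q'| is a power of 3. It is not 1, since otherwise Q is an abelian group and |Z(Q)| = 27.
  have hdvd : (derivedSubloop Q).carrier.ncard ∣ 3 ^ 3 :=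
    ⟨_, by rw [← Nat.card_coe_set_eq, mul_comm, ← Subloop.card_eq_card_factor_mul, hcard]; rfl⟩
  rw [Nat.dvd_prime_pow Nat.prime_three] at hdvd
  obtain ⟨k, -, hk⟩ := hdvd
  have hZ' : (center Q).ncard = 3 := hZ
  rw [hZ', hk]
  refine Nat.le_self_pow ?_ 3
  rintro rfl
  obtain ⟨a, ha⟩ := Set.ncard_eq_one.1 hk
  have h1 : (1 : Q) ∈ ({a} : Set Q) := ha ▸ (derivedSubloop Q).one_mem
  obtain rfl : 1 = a := h1
  rw [(derivedSubloop_eq_one_iff.1 ha).center_eq_univ, Set.ncard_univ, hcard] at hZ'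
  omega

theorem center_eq_derivedSubloop_of_card_derivedSubloop (hQ : IsBol Q) (hcard : Nat.card Q = 27)
    (hD : Nat.card (derivedSubloop Q).carrier = 3) : center Q = (derivedSubloop Q).carrier := by
  obtain ⟨A, _, π, hπ, hker, hA⟩ := (derivedSubloop_isLeast (Q := Q)).1.exists_hom
  rw [hcard, hD] at hA
  have hA : Nat.card A = 9 := by omega
  have : Finite A := Nat.finite_of_card_ne_zero (by omega)
  have hsub : ∀ x, π x = 1 → x ∈ center Q := fun x hx =>
    hQ.mem_center_of_card_ker (by rw [hA]; decide) π hπ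
      ((Nat.card_congr (Equiv.subtypeEquivRight hker)).trans hD) hx
  refine Set.Subset.antisymm (fun z hz => ?_) fun x hx => hsub x ((hker x).2 hx)
  by_contra hzD
  -- The image of the center in A ≅ Q/Q'. It is nontrivial if Z(Q) exceeds Q', and then A/B has
  -- order dividing 3.
  let B : Subgroup A :=
    { carrier := π '' center Q
      one_mem' := ⟨1, one_mem_center, map_one π⟩
      mul_mem' := by
        rintro _ _ ⟨x, hx, rfl⟩ ⟨y, hy, rfl⟩
        exact ⟨x * y, mul_mem_center hx hy, map_mul π x y⟩
      inv_mem' := by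
        rintro _ ⟨x, hx, rfl⟩
        refine ⟨_, ldiv_one_mem_center hx, eq_inv_of_mul_eq_one_right ?_⟩
        rw [← map_mul, Loop.mul_ldiv, map_one] }
  have hB : Nat.card B ≠ 1 := by
    intro h
    have h1 : π z ∈ B := ⟨z, hz, rfl⟩
    rw [Subgroup.card_eq_one.1 h, Subgroup.mem_bot] at h1
    exact hzD ((hker z).1 h1)
  have hdvd : Nat.card (A ⧸ B) ∣ 3 := by
    have h1 := B.card_eq_card_quotient_mul_card_subgroup
    have h2 : Nat.card B ∣ 3 ^ 2 := ⟨_, by rw [mul_comm, ← h1, hA]; rfl⟩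
    rw [Nat.dvd_prime_pow Nat.prime_three] at h2
    obtain ⟨k, hk, h2⟩ := h2
    rw [hA, h2] at h1
    interval_cases k
    · exact absurd h2 hB
    · exact ⟨1, by omega⟩
    · exact ⟨3, by omega⟩
  have := isCyclic_of_card_dvd_prime (p := 3) hdvd
  have hab : IsAbelianGroup Q := by
    -- The kernel of Q → A/B is Z(Q) · Q', which lies in Z(Q) because Q' is central.
    refine hQ.isAbelianGroup_of_isCyclic ((QuotientGroup.mk' B).comp π)
      ((QuotientGroup.mk'_surjective B).comp hπ) fun q hq => ?_
    obtain ⟨w, hw, hwq⟩ := (QuotientGroup.eq_one_iff (π q)).1 hq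
    rw [← Loop.mul_ldiv w q]
    refine mul_mem_center hw (hsub _ ?_)
    have h := congrArg π (Loop.mul_ldiv w q)
    rwa [map_mul, hwq, mul_eq_left] at h
  rw [derivedSubloop_eq_one_iff.2 hab] at hD
  simp at hD

end OrderTwentySeven

end LoopTheory

theorem corollary4p10 {Q : Type*} [LoopTheory.Loop Q] (hBol : LoopTheory.IsBol Q)
    (hcard : Nat.card Q = 27)
    (h : Nat.card (LoopTheory.center Q) = 3 ∨
      Nat.card (LoopTheory.derivedSubloop Q).carrier = 3) :
    LoopTheory.center Q = (LoopTheory.derivedSubloop Q).carrier :=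
  h.elim (LoopTheory.center_eq_derivedSubloop_of_card_center hBol hcard)
    (LoopTheory.center_eq_derivedSubloop_of_card_derivedSubloop hBol hcard)
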